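/- Let $n\ge 1$, $\mathbf R^{n+1}_+=\{x\in\mathbf R^{n+1}:x_{n+1}>0\}$, $E_{n+1}=(0,\dots,0,1)$, and let $\mathcal H^k$ be the $k$-dimensional Hausdorff measure. A Borel set $A\subset\mathbf R^{n+1}$ is locally $\mathcal H^k$-rectifiable if, up to an $\mathcal H^k$-null set, it is covered by countably many Lipschitz images of $\mathbf R^k$, and $\mathcal H^k\llcorner A$ is locally finite; it is normalized if $A={\rm spt}(\mathcal H^k\llcorner A)$. We call ${\rm var}(A,\psi)$ a rectifiable $k$-cone if $A$ is a normalized locally $\mathcal H^k$-rectifiable set with $tA=A$ for all $t>0$, and $\psi$ is a positive locally $\mathcal H^k$-integrable function on $A$ with $\psi(tx)=\psi(x)$ for $x\in A$, $t>0$. Let $\mathfrak X$ be the set of compactly supported $C^1$ vector fields $X$ on $\mathbf R^{n+1}$ with $X\cdot E_{n+1}\ge 0$ on $\partial\mathbf R^{n+1}_+$, and $\mathfrak X_t\subset\mathfrak X$ the subset of those with $X\cdot E_{n+1}=0$ on $\partial\mathbf R^{n+1}_+$. Here ${\rm div}_MX(x)$ denotes the trace of $dX_x$ over the tangent plane $T_xM$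 (defined for $\mathcal H^n$-a.e. $x\in M$), and ${\rm div}_{\partial\mathbf R^{n+1}_+}X$ its trace over $E_{n+1}^\perp$. Let $\theta\in[\pi/2,\pi)$. Let $M\subset\overline{\mathbf R^{n+1}_+}$ and $T,\Gamma\subset\partial\mathbf R^{n+1}_+$ be such that ${\rm var}(M,\psi_1)$ and ${\rm var}(T,\psi_2)$ are rectifiable $n$-cones and ${\rm var}(\Gamma,\psi_3)$ is a rectifiable $(n-1)$-cone. Suppose that the triple $({\rm var}(M,\psi_1),{\rm var}(T,\psi_2),{\rm var}(\Gamma,\psi_3))$ is $\theta$-stationary, i.e. $$\int_M\psi_1\,{\rm div}_MX\,d\mathcal H^n+\cos(\pi-\theta)\int_T\psi_2\,{\rm div}_{\partial\mathbf R^{n+1}_+}X\,d\mathcal H^n=-\sin\theta\int_\Gamma\psi_3\,X\cdot E_{n+1}\,d\mathcal H^{n-1}\qquad\text{for all }X\in\mathfrak X,$$ and there is an $\mathcal H^{n-1}\llcorner\Gamma$-measurable vector field $\bar\nu$ with $|\bar\nu|=1$ $\mathcal H^{n-1}$-a.e. on $\Gamma$ such that $$\int_T\psi_2\,{\rm div}_{\partial\mathbf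 R^{n+1}_+}X\,d\mathcal H^n=\int_\Gamma\psi_3\,X\cdot\bar\nu\,d\mathcal H^{n-1}\qquad\text{for all }X\in\mathfrak X_t.$$ Let $\nu\in\mathbf S^n$ and suppose that $M$ is contained in the closed half-space $H^-=\{z\in\mathbf R^{n+1}:z\cdot\nu\le 0\}$. Assume that $M\neq\emptyset$, and that $\Gamma\neq\emptyset$ in the degenerate case $\nu=E_{n+1}$. Then $\alpha:=\arccos(\nu\cdot(-E_{n+1}))$ satisfies $\alpha\le\theta$. Moreover, if $\alpha=\theta$, then $M=\partial H^-\cap\overline{\mathbf R^{n+1}_+}$. -/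

import Mathlib

namespace CapillaryCone

open MeasureTheory Measure Set
open scoped NNReal ENNReal

noncomputable section

/-- Euclidean space `ℝ^m`. Throughout, `μHE[k]` is Mathlib's `k`-dimensional Hausdorff measure,
normalized so as to agree with Lebesgue measure on `ℝ^k`. -/
abbrev Eu (m : ℕ) : Type := EuclideanSpace ℝ (Fin m)

/-! ### Rectifiable sets and their tangent planes -/

/-- Locally `ℋ^k`-rectifiable sets: `M` is Borel, covered up to an `ℋ^k`-null set by countably many Lipschitz images of `ℝ^k`, and
`ℋ^k ⌞ M` is locally finite. -/
structure IsLocallyRectifiable (k : ℕ) {m : ℕ} (M : Set (Eu m)) : Prop where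
  measurableSet : MeasurableSet M
  exists_cover : ∃ g : ℕ → Eu k → Eu m, (∀ i, ∃ K, LipschitzWith K (g i)) ∧
    μHE[k] (M \ ⋃ i, range (g i)) = 0
  locallyFinite : IsLocallyFiniteMeasure ((μHE[k] : Measure (Eu m)).restrict M)

/-- `τ` is the field of (approximate) tangent `k`-planes `x ↦ T_x M` of a locally `ℋ^k`-rectifiable
set `M`: for every Lipschitz map `g : ℝ^k → ℝ^m`, at `ℋ^k`-a.e. `x ∈ M` one has
`T_x M = dg_u (ℝ^k)` at each `u` with `g u = x`. This determines `τ` up to `ℋ^k ⌞ M`-null sets. -/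
def IsTangentField (k : ℕ) {m : ℕ} (M : Set (Eu m)) (τ : Eu m → Submodule ℝ (Eu m)) : Prop :=
  (∀ᵐ x ∂((μHE[k] : Measure (Eu m)).restrict M), Module.finrank ℝ (τ x) = k) ∧
  ∀ g : Eu k → Eu m, (∃ K, LipschitzWith K g) →
    ∀ᵐ x ∂((μHE[k] : Measure (Eu m)).restrict M), ∀ u, g u = x →
      DifferentiableAt ℝ g u ∧ (fderiv ℝ g u).range = τ x

/-! Existence and a.e. uniqueness of the tangent plane field. -/

theorem null_image {k m : ℕ} {g : Eu k → Eu m} {K : ℝ≥0} (hg : LipschitzWith K g)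
    {S : Set (Eu k)} (hS : volume S = 0) : μHE[k] (g '' S) = 0 := by
  have h1 : μH[(k : ℝ)] S = 0 := by
    have : (μH[(k:ℝ)] : Measure (Eu k)).IsAddHaarMeasure := by
      simpa using MeasureTheory.isAddHaarMeasure_hausdorffMeasure (E := Eu k)
    rw [isAddLeftInvariant_eq_smul (μH[(k:ℝ)] : Measure (Eu k)) volume]
    simp [hS]
  have h2 := hg.hausdorffMeasure_image_le (d := k) (by positivity) S
  rw [h1, mul_zero] at h2
  rw [euclideanHausdorffMeasure_def]
  simp [nonpos_iff_eq_zero.1 h2]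

theorem ae_fderiv_zero {k m : ℕ} {f : Eu k → Eu m} (hf : Continuous f) :
    volume {u | f u = 0 ∧ DifferentiableAt ℝ f u ∧ fderiv ℝ f u ≠ 0} = 0 := by
  set s : Set (Eu k) := {u | f u = 0} ∩ {u | DifferentiableAt ℝ f u}
  have hs : MeasurableSet s :=
    (isClosed_eq hf continuous_const).measurableSet.inter (measurableSet_of_differentiableAt ℝ f)
  have key : ∀ (i : Fin m) (j : Fin k), ∀ᵐ u ∂(volume.restrict s), 
      ∀ z, (fderiv ℝ f u z) i = 0 := by
    intro i j
    let L : Eu m →L[ℝ] Eu k :=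
      (EuclideanSpace.proj i : Eu m →L[ℝ] ℝ).smulRight (EuclideanSpace.single j (1 : ℝ))
    have hA : ApproximatesLinearOn (fun u => L (f u)) (0 : Eu k →L[ℝ] Eu k) s 0 := by
      intro x hx y hy
      simp [show f x = 0 from hx.1, show f y = 0 from hy.1]
    have := hA.norm_fderiv_sub_le volume hs (fun u => L ∘L fderiv ℝ f u) (fun x hx =>
      (L.hasFDerivAt.comp x (show DifferentiableAt ℝ f x from hx.2).hasFDerivAt).hasFDerivWithinAt)
    filter_upwards [this] with u hu z
    have h0 : L ∘L fderiv ℝ f u = 0 := by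
      simpa using hu
    have := congrArg (fun w : Eu k => w j) (DFunLike.congr_fun h0 z)
    simpa [L] using this
  have all : ∀ᵐ u ∂(volume.restrict s), fderiv ℝ f u = 0 := by
    have : ∀ᵐ u ∂(volume.restrict s), ∀ i : Fin m, ∀ j : Fin k, ∀ z, (fderiv ℝ f u z) i = 0 :=
      ae_all_iff.2 fun i => ae_all_iff.2 fun j => key i j
    filter_upwards [this] with u hu
    ext z i
    by_cases hk : Nonempty (Fin k)
    · obtain ⟨j⟩ := hk
      simpa using hu i j z
    · have : IsEmpty (Fin k) := not_nonempty_iff.1 hk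
      have : z = 0 := Subsingleton.elim _ _
      simp [this]
  rw [ae_restrict_iff' hs, ae_iff] at all
  refine measure_mono_null ?_ all
  rintro u ⟨h1, h2, h3⟩
  simp only [mem_ofPred_eq, Classical.not_imp]
  exact ⟨⟨h1, h2⟩, h3⟩

theorem pair_null {k m : ℕ} {g h : Eu k → Eu m} {K K' : ℝ≥0} (hg : LipschitzWith K g)
    (hh : LipschitzWith K' h) :
    μHE[k] {x | ∃ u v, g u = x ∧ h v = x ∧ DifferentiableAt ℝ g u ∧ DifferentiableAt ℝ h v ∧
      Function.Injective (fderiv ℝ g u) ∧ Function.Injective (fderiv ℝ h v) ∧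
      (fderiv ℝ g u).range ≠ (fderiv ℝ h v).range} = 0 := by
  classical
  set G : Set (Eu k) := {v | DifferentiableAt ℝ h v ∧ Function.Injective (fderiv ℝ h v)}
  have hA : ∀ A : Eu k →L[ℝ] Eu m, ∃ c : ℝ≥0, c ≠ 0 ∧ (Function.Injective A → ∀ z, 2 * c * ‖z‖ ≤ ‖A z‖) := by
    intro A
    by_cases hi : Function.Injective A
    · obtain ⟨C, hC, hanti⟩ := LinearMap.exists_antilipschitzWith (A : Eu k →ₗ[ℝ] Eu m)
        (LinearMap.ker_eq_bot.2 hi)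
      refine ⟨(2 * C)⁻¹, by positivity, fun _ z => ?_⟩
      have := hanti.le_mul_dist z 0
      simp only [dist_zero_right, map_zero, ContinuousLinearMap.coe_coe] at this
      have hC' : (0:ℝ) < C := hC
      push_cast
      rw [show (2:ℝ) * (2 * (C:ℝ))⁻¹ * ‖z‖ = ‖z‖ / C by field_simp, div_le_iff₀ hC']
      linarith
    · exact ⟨1, one_ne_zero, fun h => absurd h hi⟩
  choose r hr0 hr using hA
  obtain ⟨t, A, -, hcov, happ, hAy⟩ := exists_closed_cover_approximatesLinearOn_of_hasFDerivWithinAt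
    h G (fderiv ℝ h) (fun x hx => hx.1.hasFDerivAt.hasFDerivWithinAt) r hr0
  -- local Lipschitz inverses
  have hW : ∀ n, ∃ W : Eu m → Eu k, (∃ C, LipschitzWith C W) ∧ ∀ v ∈ G ∩ t n, W (h v) = v := by
    intro n
    have hbound : ∀ v ∈ G ∩ t n, ∀ v' ∈ G ∩ t n, r (A n) * ‖v - v'‖ ≤ ‖h v - h v'‖ := by
      intro v hv v' hv'
      obtain ⟨y, hy, hAny⟩ := hAy ⟨v, hv.1⟩ n
      have h1 := hr (A n) (hAny ▸ hy.2) (v - v')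
      have h2 := happ n v hv v' hv'
      have h3 : ‖A n (v - v')‖ ≤ ‖h v - h v' - A n (v - v')‖ + ‖h v - h v'‖ := by
        have := norm_sub_le (h v - h v') (h v - h v' - A n (v - v'))
        simpa [add_comm] using this
      linarith
    have hr' : (0 : ℝ) < r (A n) := lt_of_le_of_ne (r (A n)).2 (by exact_mod_cast (hr0 (A n)).symm)
    have hinj : InjOn h (G ∩ t n) := by
      intro v hv v' hv' e
      have := hbound v hv v' hv'
      rw [e, sub_self, norm_zero] at this
      have h0 : ‖v - v'‖ ≤ 0 := by
        by_contra hc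
        have := mul_pos hr' (not_le.1 hc)
        linarith
      exact sub_eq_zero.1 (norm_le_zero_iff.1 h0)
    have hl : LipschitzOnWith (r (A n))⁻¹ (Function.invFunOn h (G ∩ t n)) (h '' (G ∩ t n)) := by
      refine LipschitzOnWith.of_dist_le_mul ?_
      rintro _ ⟨v, hv, rfl⟩ _ ⟨v', hv', rfl⟩
      rw [hinj.leftInvOn_invFunOn hv, hinj.leftInvOn_invFunOn hv', dist_eq_norm, dist_eq_norm]
      push_cast
      rw [inv_mul_eq_div, le_div_iff₀ hr', mul_comm]
      exact hbound v hv v' hv'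
    obtain ⟨W, hWl, hWe⟩ := hl.extend_finite_dimension
    exact ⟨W, ⟨_, hWl⟩, fun v hv => by
      rw [← hWe (mem_image_of_mem h hv), hinj.leftInvOn_invFunOn hv]⟩
  choose W hWl hWinv using hW
  choose C hWl using hWl
  let N : ℕ → Set (Eu k) := fun n =>
    {u | ¬ DifferentiableAt ℝ (W n ∘ g) u} ∪
    {u | (g u - h (W n (g u))) = 0 ∧ DifferentiableAt ℝ (fun u => g u - h (W n (g u))) u ∧
      fderiv ℝ (fun u => g u - h (W n (g u))) u ≠ 0}
  have hN : ∀ n, volume (N n) = 0 := by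
    intro n
    refine measure_union_null ?_ ?_
    · exact ((hWl n).comp hg).ae_differentiableAt
    · exact ae_fderiv_zero (hg.continuous.sub
        (hh.continuous.comp ((hWl n).continuous.comp hg.continuous)))
  refine measure_mono_null ?_ (measure_iUnion_null fun n => null_image hg (hN n))
  rintro x ⟨u, v, hu, hv, dg, dh, ig, ih, hne⟩
  obtain ⟨n, hn⟩ := mem_iUnion.1 (hcov (show v ∈ G from ⟨dh, ih⟩))
  refine mem_iUnion.2 ⟨n, u, ?_, hu⟩
  by_contra hnot
  have hWv : W n (g u) = v := by
    rw [hu, ← hv]; exact hWinv n v ⟨⟨dh, ih⟩, hn⟩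
  have hdW : DifferentiableAt ℝ (W n ∘ g) u := by
    by_contra hc; exact hnot (Or.inl hc)
  have hcomp : HasFDerivAt (fun u => h (W n (g u)))
      (fderiv ℝ h v ∘L fderiv ℝ (W n ∘ g) u) u := by
    have hd : HasFDerivAt h (fderiv ℝ h v) ((W n ∘ g) u) := by
      simpa [hWv] using dh.hasFDerivAt
    exact hd.comp u hdW.hasFDerivAt
  have hsub := dg.hasFDerivAt.sub hcomp
  have hz : fderiv ℝ g u - fderiv ℝ h v ∘L fderiv ℝ (W n ∘ g) u = 0 := by
    by_contra hc
    refine hnot (Or.inr ⟨by rw [hWv, hu, hv, sub_self], hsub.differentiableAt, ?_⟩)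
    rw [show (fun u => g u - h (W n (g u))) = g - fun u => h (W n (g u)) from rfl, hsub.fderiv]
    exact hc
  have heq := sub_eq_zero.1 hz
  apply hne
  have hle : (fderiv ℝ g u).range ≤ (fderiv ℝ h v).range := by
    rintro _ ⟨z, rfl⟩
    rw [heq]
    exact ⟨fderiv ℝ (W n ∘ g) u z, rfl⟩
  refine Submodule.eq_of_le_of_finrank_eq hle ?_
  rw [LinearMap.finrank_range_of_inj ig, LinearMap.finrank_range_of_inj ih]

theorem sard_null {k m : ℕ} {g : Eu k → Eu m} {K : ℝ≥0} (hg : LipschitzWith K g) :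
    μHE[k] (g '' {u | DifferentiableAt ℝ g u ∧ ¬ Function.Injective (fderiv ℝ g u)}) = 0 := by
  have hHaar : (μH[(k:ℝ)] : Measure (Eu k)).IsAddHaarMeasure := by
    simpa using MeasureTheory.isAddHaarMeasure_hausdorffMeasure (E := Eu k)
  set ν : Measure (Eu k) := μH[(k:ℝ)] with hν
  -- estimate on a piece
  have piece : ∀ (ε : ℝ≥0), 0 < ε → ε ≤ 1 → ∀ (A : Eu k →L[ℝ] Eu m) (s : Set (Eu k)),
      ‖A‖ ≤ K → ¬ Function.Injective A → ApproximatesLinearOn g A s ε →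
      μH[(k:ℝ)] (g '' s) ≤ (2 ^ k * (K + 1) ^ k * ε : ℝ≥0) * ν s := by
    intro ε hε hε1 A s hAK hinj happ
    obtain ⟨w, hw, hAw⟩ : ∃ w : Eu k, ‖w‖ = 1 ∧ A w = 0 := by
      rw [injective_iff_map_eq_zero] at hinj
      push Not at hinj
      obtain ⟨w, hw, hw0⟩ := hinj
      exact ⟨(‖w‖⁻¹ : ℝ) • w, by simp [norm_smul, hw0], by simp [hw]⟩
    let a : ℝ := K + 1
    have ha : 1 ≤ a := by simp [a]
    have ha0 : 0 < a := by linarith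
    -- the anisotropic dilation
    let D : Eu k →ₗ[ℝ] Eu k :=
      a • LinearMap.transvection (innerₛₗ ℝ w) ((ε / a - 1 : ℝ) • w)
    have hDz : ∀ z, D z = a • (z - (inner ℝ w z) • w) + (ε * inner ℝ w z) • w := by
      intro z
      have e : D z = a • (z + (inner ℝ w z) • ((ε / a - 1 : ℝ) • w)) := rfl
      have e2 : (ε : ℝ) = a * (ε / a) := by field_simp
      rw [e]
      nth_rewrite 2 [e2]
      module
    have hdet : |LinearMap.det D| ≤ a ^ k * ε := by
      have e : LinearMap.det D = a ^ k * (ε / a) := by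
        simp only [D, LinearMap.det_smul, LinearMap.transvection.det]
        simp [hw]
      rw [e, abs_of_nonneg (by positivity)]
      gcongr
      exact div_le_self ε.2 ha
    have hlip : ∀ x ∈ s, ∀ y ∈ s, dist (g x) (g y) ≤ 2 * dist (D x) (D y) := by
      intro x hx y hy
      rw [dist_eq_norm, dist_eq_norm, ← map_sub, hDz]
      have h1 := happ x hx y hy
      set z := x - y
      set c : ℝ := inner ℝ w z
      set p := z - c • w
      have hz : z = p + c • w := by simp [p]
      have hAz : A z = A p := by rw [hz]; simp [hAw]
      have hAp : ‖A p‖ ≤ K * ‖p‖ := A.le_of_opNorm_le hAK p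
      have hzn : ‖z‖ ≤ ‖p‖ + |c| := by
        calc ‖z‖ = ‖p + c • w‖ := by rw [← hz]
          _ ≤ ‖p‖ + ‖c • w‖ := norm_add_le _ _
          _ = ‖p‖ + |c| := by rw [norm_smul, hw, mul_one, Real.norm_eq_abs]
      have hpw : inner ℝ p w = (0:ℝ) := by
        simp only [p, inner_sub_left, inner_smul_left, real_inner_self_eq_norm_sq, hw]
        simp [c, real_inner_comm]
      have hpy : ‖a • p + (ε * c) • w‖ ^ 2 = (a * ‖p‖) ^ 2 + (ε * |c|) ^ 2 := by
        rw [norm_add_sq_real, inner_smul_left, inner_smul_right, hpw, norm_smul, norm_smul, hw,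
          Real.norm_eq_abs, Real.norm_eq_abs, abs_mul, abs_of_pos ha0, NNReal.abs_eq]
        ring
      have hN : 0 ≤ ‖a • p + (ε * c) • w‖ := norm_nonneg _
      have b1 : a * ‖p‖ ≤ ‖a • p + (ε * c) • w‖ := by
        apply le_of_sq_le_sq _ hN
        rw [hpy]; nlinarith [sq_nonneg ((ε:ℝ) * |c|)]
      have b2 : ε * |c| ≤ ‖a • p + (ε * c) • w‖ := by
        apply le_of_sq_le_sq _ hN
        rw [hpy]; nlinarith [sq_nonneg (a * ‖p‖)]
      have h3 : ‖g x - g y‖ ≤ ‖A z‖ + ε * ‖z‖ := by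
        have := norm_add_le (g x - g y - A z) (A z)
        rw [sub_add_cancel] at this
        linarith
      have hε' : (ε:ℝ) ≤ 1 := by exact_mod_cast hε1
      have h4 : ε * ‖z‖ ≤ ‖p‖ + ε * |c| := by
        calc ε * ‖z‖ ≤ ε * (‖p‖ + |c|) := by gcongr
          _ = ε * ‖p‖ + ε * |c| := by ring
          _ ≤ 1 * ‖p‖ + ε * |c| := by gcongr
          _ = _ := by ring
      rw [hAz] at h3
      have h5 : a * ‖p‖ = K * ‖p‖ + ‖p‖ := by simp only [a]; ring
      linarith
    have himg : g '' s = (g ∘ Function.invFunOn D s) '' (D '' s) := by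
      rw [image_image]
      refine image_congr fun x hx => ?_
      have hmem : D x ∈ D '' s := mem_image_of_mem D hx
      have e := hlip _ (Function.invFunOn_mem hmem) x hx
      rw [Function.invFunOn_eq hmem, dist_self, mul_zero] at e
      exact (dist_le_zero.1 e).symm
    have hl : LipschitzOnWith 2 (g ∘ Function.invFunOn D s) (D '' s) := by
      refine LipschitzOnWith.of_dist_le_mul fun p hp q hq => ?_
      have := hlip _ (Function.invFunOn_mem hp) _ (Function.invFunOn_mem hq)
      rwa [Function.invFunOn_eq hp, Function.invFunOn_eq hq] at this
    calc μH[(k:ℝ)] (g '' s) ≤ (2:ℝ≥0) ^ (k:ℝ) * ν (D '' s) := by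
          rw [himg]; exact_mod_cast hl.hausdorffMeasure_image_le (d := k) (by positivity)
      _ ≤ (2:ℝ≥0) ^ (k:ℝ) * (ENNReal.ofReal (a ^ k * ε) * ν s) := by
          rw [addHaar_image_linearMap]
          gcongr
      _ = (2 ^ k * (K + 1) ^ k * ε : ℝ≥0) * ν s := by
          have : ENNReal.ofReal (a ^ k * ε) = (((K + 1) ^ k * ε : ℝ≥0) : ℝ≥0∞) := by
            rw [← ENNReal.ofReal_coe_nnreal]; simp [a]
          rw [this, ← mul_assoc]
          push_cast
          rw [ENNReal.rpow_natCast]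
          ring
  set S : Set (Eu k) := {u | DifferentiableAt ℝ g u ∧ ¬ Function.Injective (fderiv ℝ g u)}
  have hball : ∀ R : ℕ, μH[(k:ℝ)] (g '' (S ∩ Metric.closedBall 0 R)) = 0 := by
    intro R
    set SR := S ∩ Metric.closedBall (0 : Eu k) R
    have hfin : ν (Metric.closedBall (0 : Eu k) R) ≠ ⊤ := measure_closedBall_lt_top.ne
    have hε : ∀ ε : ℝ≥0, 0 < ε → ε ≤ 1 → μH[(k:ℝ)] (g '' SR) ≤
        (2 ^ k * (K + 1) ^ k * ε : ℝ≥0) * ν (Metric.closedBall (0 : Eu k) R) := by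
      intro ε h0 h1
      obtain ⟨t, A, hdisj, hmeas, hcov, happ, hAy⟩ :=
        exists_partition_approximatesLinearOn_of_hasFDerivWithinAt g SR (fderiv ℝ g)
          (fun x hx => hx.1.1.hasFDerivAt.hasFDerivWithinAt) (fun _ => ε) (fun _ => h0.ne')
      have hp : ∀ n, μH[(k:ℝ)] (g '' (SR ∩ t n)) ≤
          (2 ^ k * (K + 1) ^ k * ε : ℝ≥0) * ν (SR ∩ t n) := by
        intro n
        rcases SR.eq_empty_or_nonempty with he | hne
        · simp [he]
        · obtain ⟨y, hy, hAn⟩ := hAy hne n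
          refine piece ε h0 h1 (A n) _ ?_ ?_ (happ n)
          · rw [hAn]; exact norm_fderiv_le_of_lipschitz ℝ hg
          · rw [hAn]; exact hy.1.2
      calc μH[(k:ℝ)] (g '' SR) ≤ μH[(k:ℝ)] (⋃ n, g '' (SR ∩ t n)) := by
            refine measure_mono ?_
            rw [← image_iUnion, ← inter_iUnion, inter_eq_left.2 hcov]
        _ ≤ ∑' n, μH[(k:ℝ)] (g '' (SR ∩ t n)) := measure_iUnion_le _
        _ ≤ ∑' n, (2 ^ k * (K + 1) ^ k * ε : ℝ≥0) * ν (SR ∩ t n) := ENNReal.tsum_le_tsum hp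
        _ = (2 ^ k * (K + 1) ^ k * ε : ℝ≥0) * ν.restrict SR (⋃ n, t n) := by
            rw [ENNReal.tsum_mul_left, measure_iUnion hdisj hmeas]
            simp_rw [restrict_apply (hmeas _), inter_comm]
        _ ≤ _ := by
            refine mul_le_mul' le_rfl ?_
            calc ν.restrict SR (⋃ n, t n) ≤ ν.restrict SR univ := measure_mono (subset_univ _)
              _ = ν SR := by simp
              _ ≤ _ := measure_mono inter_subset_right
    set B := ν (Metric.closedBall (0 : Eu k) R)
    have hlim : Filter.Tendsto (fun ε : ℝ≥0 => ((2 ^ k * (K + 1) ^ k * ε : ℝ≥0) : ℝ≥0∞) * B)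
        (nhdsWithin 0 (Ioi 0)) (nhds 0) := by
      have : Filter.Tendsto (fun ε : ℝ≥0 => ((2 ^ k * (K + 1) ^ k * ε : ℝ≥0) : ℝ≥0∞) * B)
          (nhds 0) (nhds (((2 ^ k * (K + 1) ^ k * 0 : ℝ≥0) : ℝ≥0∞) * B)) := by
        refine ENNReal.Tendsto.mul_const ?_ (Or.inr hfin)
        exact ENNReal.tendsto_coe.2 (Continuous.tendsto (by fun_prop) 0)
      simpa using this.mono_left nhdsWithin_le_nhds
    refine nonpos_iff_eq_zero.1 (ge_of_tendsto hlim ?_)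
    filter_upwards [Ioc_mem_nhdsGT (zero_lt_one (α := ℝ≥0))] with ε hh
    exact hε ε hh.1 hh.2
  have hall : μH[(k:ℝ)] (g '' S) = 0 := by
    rw [← Metric.iUnion_inter_closedBall_nat S 0, image_iUnion]
    exact measure_iUnion_null hball
  rw [euclideanHausdorffMeasure_def]
  simp [hall]

theorem IsLocallyRectifiable.exists_isTangentField {k m : ℕ} {M : Set (Eu m)}
    (hM : IsLocallyRectifiable k M) : ∃ τ, IsTangentField k M τ := by
  classical
  obtain ⟨g, hg, hcov⟩ := hM.exists_cover
  have good : ∀ f : Eu k → Eu m, (∃ K, LipschitzWith K f) →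
      ∀ᵐ x ∂(μHE[k] : Measure (Eu m)), ∀ u, f u = x →
        DifferentiableAt ℝ f u ∧ Function.Injective (fderiv ℝ f u) := by
    rintro f ⟨K, hf⟩
    have h1 := null_image hf (ae_iff.1 (hf.ae_differentiableAt (μ := volume)))
    have h2 := sard_null hf
    filter_upwards [compl_mem_ae_iff.2 h1, compl_mem_ae_iff.2 h2] with x hx1 hx2 u hu
    have hd : DifferentiableAt ℝ f u := by
      by_contra hc
      exact hx1 ⟨u, hc, hu⟩
    refine ⟨hd, ?_⟩
    by_contra hc
    exact hx2 ⟨u, ⟨hd, hc⟩, hu⟩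
  have same : ∀ f f' : Eu k → Eu m, (∃ K, LipschitzWith K f) → (∃ K, LipschitzWith K f') →
      ∀ᵐ x ∂(μHE[k] : Measure (Eu m)), ∀ u v, f u = x → f' v = x →
        (fderiv ℝ f u).range = (fderiv ℝ f' v).range := by
    rintro f f' ⟨K, hf⟩ ⟨K', hf'⟩
    filter_upwards [good f ⟨K, hf⟩, good f' ⟨K', hf'⟩, compl_mem_ae_iff.2 (pair_null hf hf')]
      with x h1 h2 h3 u v hu hv
    by_contra hc
    exact h3 ⟨u, v, hu, hv, (h1 u hu).1, (h2 v hv).1, (h1 u hu).2, (h2 v hv).2, hc⟩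
  let τ : Eu m → Submodule ℝ (Eu m) := fun x =>
    if h : ∃ p : ℕ × Eu k, g p.1 p.2 = x then (fderiv ℝ (g h.choose.1) h.choose.2).range else ⊥
  have hcov' : ∀ᵐ x ∂((μHE[k] : Measure (Eu m)).restrict M), ∃ p : ℕ × Eu k, g p.1 p.2 = x := by
    rw [ae_restrict_iff' hM.measurableSet]
    filter_upwards [compl_mem_ae_iff.2 hcov] with x hx hxM
    by_contra hc
    refine hx ⟨hxM, fun hmem => ?_⟩
    obtain ⟨i, u, hu⟩ := mem_iUnion.1 hmem
    exact hc ⟨(i, u), hu⟩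
  refine ⟨τ, ?_, fun f hf => ?_⟩
  · have h1 : ∀ᵐ x ∂(μHE[k] : Measure (Eu m)), ∀ i, ∀ u, g i u = x →
        DifferentiableAt ℝ (g i) u ∧ Function.Injective (fderiv ℝ (g i) u) :=
      ae_all_iff.2 fun i => good (g i) (hg i)
    filter_upwards [hcov', ae_restrict_of_ae h1] with x hx h1
    have hτ : τ x = (fderiv ℝ (g hx.choose.1) hx.choose.2).range := dif_pos hx
    rw [hτ, LinearMap.finrank_range_of_inj (h1 _ _ hx.choose_spec).2]
    simp
  · have h2 : ∀ᵐ x ∂(μHE[k] : Measure (Eu m)), ∀ i, ∀ u v, f u = x → g i v = x →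
        (fderiv ℝ f u).range = (fderiv ℝ (g i) v).range :=
      ae_all_iff.2 fun i => same f (g i) hf (hg i)
    filter_upwards [hcov', ae_restrict_of_ae (good f hf), ae_restrict_of_ae h2] with x hx h1 h2 u hu
    refine ⟨(h1 u hu).1, ?_⟩
    simp only [τ, dif_pos hx]
    exact h2 _ u _ hu hx.choose_spec

theorem IsTangentField.ae_eq {k m : ℕ} {M : Set (Eu m)} (hM : IsLocallyRectifiable k M)
    {τ τ' : Eu m → Submodule ℝ (Eu m)} (h : IsTangentField k M τ) (h' : IsTangentField k M τ') :
    ∀ᵐ x ∂((μHE[k] : Measure (Eu m)).restrict M), τ x = τ' x := by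
  obtain ⟨g, hg, hcov⟩ := hM.exists_cover
  have hcov' : ∀ᵐ x ∂((μHE[k] : Measure (Eu m)).restrict M), x ∈ ⋃ i, range (g i) := by
    rw [ae_restrict_iff' hM.measurableSet]
    filter_upwards [compl_mem_ae_iff.2 hcov] with x hx hxM
    by_contra hc
    exact hx ⟨hxM, hc⟩
  filter_upwards [hcov', ae_all_iff.2 fun i => h.2 (g i) (hg i),
    ae_all_iff.2 fun i => h'.2 (g i) (hg i)] with x hx h1 h2
  obtain ⟨i, u, hu⟩ := mem_iUnion.1 hx
  exact (h1 i u hu).2.symm.trans (h2 i u hu).2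

open Classical in
/-- The tangent plane `T_x M` of a locally `ℋ^k`-rectifiable set `M` (for `ℋ^k`-a.e. `x ∈ M`). -/
def tangentPlane (k : ℕ) {m : ℕ} (M : Set (Eu m)) : Eu m → Submodule ℝ (Eu m) :=
  if h : ∃ τ, IsTangentField k M τ then h.choose else fun _ => ⊥

theorem IsLocallyRectifiable.isTangentField_tangentPlane {k m : ℕ} {M : Set (Eu m)}
    (hM : IsLocallyRectifiable k M) : IsTangentField k M (tangentPlane k M) := by
  have h := hM.exists_isTangentField
  rw [tangentPlane, dif_pos h]
  exact h.choose_spec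

/-- `M` is normalized: `M = spt (ℋ^k ⌞ M)`. -/
def IsNormalized (k : ℕ) {m : ℕ} (M : Set (Eu m)) : Prop :=
  ∀ x, x ∈ M ↔ ∀ ρ > 0, 0 < (μHE[k] : Measure (Eu m)) (Metric.ball x ρ ∩ M)

/-- `var(M, ψ)` is a rectifiable `k`-cone: `M` is a normalized locally `ℋ^k`-rectifiable set,
invariant under dilations, and `ψ` is a positive, locally `ℋ^k`-integrable density on `M`, constant
along rays. -/
structure IsRectifiableCone (k : ℕ) {m : ℕ} (M : Set (Eu m)) (ψ : Eu m → ℝ) : Prop where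
  rectifiable : IsLocallyRectifiable k M
  normalized : IsNormalized k M
  cone : ∀ t : ℝ, 0 < t → (fun x => t • x) '' M = M
  density_pos : ∀ x ∈ M, 0 < ψ x
  density_locallyIntegrable : LocallyIntegrable ψ ((μHE[k] : Measure (Eu m)).restrict M)
  density_homogeneous : ∀ x ∈ M, ∀ t : ℝ, 0 < t → ψ (t • x) = ψ x

/-- The divergence of `X` at `x` along the plane `π`, i.e. `∑ ⟪dX_x eᵢ, eᵢ⟫` over an orthonormal
basis `eᵢ` of `π`. -/
def divAlong {m : ℕ} (π : Submodule ℝ (Eu m)) (X : Eu m → Eu m) (x : Eu m) : ℝ :=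
  LinearMap.trace ℝ (Eu m) (π.starProjection ∘L fderiv ℝ X x : Eu m →L[ℝ] Eu m).toLinearMap

/-! ### The half-space `{x_{n+1} ≥ 0}` -/

/-- The unit vector `E_{n+1} = (0, …, 0, 1)` of `ℝ^{n+1}`. -/
def vertical (n : ℕ) : Eu (n + 1) := EuclideanSpace.single (Fin.last n) 1

/-- The closed upper half-space `{x_{n+1} ≥ 0}`. -/
def upperHalfSpace (n : ℕ) : Set (Eu (n + 1)) := {x | 0 ≤ x (Fin.last n)}

/-- The boundary `{x_{n+1} = 0}` of the upper half-space, as a linear subspace. -/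
def wall (n : ℕ) : Submodule ℝ (Eu (n + 1)) := (ℝ ∙ vertical n)ᗮ

/-- `C¹` vector fields on `ℝ^{n+1}` with compact support, whose value at each `p ∈ {x_{n+1} ≥ 0}`
lies in the tangent cone of the half-space at `p`: this restricts `X p` for `p` in the wall only,
where the tangent cone is the half-space itself. -/
structure IsAdmissible {n : ℕ} (X : Eu (n + 1) → Eu (n + 1)) : Prop where
  contDiff : ContDiff ℝ 1 X
  hasCompactSupport : HasCompactSupport X
  mem_tangentCone : ∀ p ∈ wall n, X p ∈ upperHalfSpace n

/-- The admissible vector fields that are tangent to the wall along the wall. -/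
structure IsTangential {n : ℕ} (X : Eu (n + 1) → Eu (n + 1)) : Prop extends IsAdmissible X where
  mem_wall : ∀ p ∈ wall n, X p ∈ wall n

/-- `(var(M, ψ₁), var(T, ψ₂), var(Γ, ψ₃))` is a `θ`-stationary triple: the first variation identity
with contact angle `θ` and zero generalized mean curvature, and the existence of a generalized unit
conormal `ν'` of `T` along `Γ`. -/
structure IsStationaryTriple {n : ℕ} (θ : ℝ) (M T Γ : Set (Eu (n + 1)))
    (ψ₁ ψ₂ ψ₃ : Eu (n + 1) → ℝ) : Prop where
  firstVariation : ∀ X, IsAdmissible X →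
    (∫ x in M, ψ₁ x * divAlong (tangentPlane n M x) X x ∂μHE[n]) +
      Real.cos (Real.pi - θ) * (∫ x in T, ψ₂ x * divAlong (wall n) X x ∂μHE[n]) =
    -Real.sin θ * (∫ x in Γ, ψ₃ x * inner ℝ (X x) (vertical n) ∂μHE[n - 1])
  exists_conormal : ∃ ν' : Eu (n + 1) → Eu (n + 1),
    AEStronglyMeasurable ν' ((μHE[n - 1] : Measure (Eu (n + 1))).restrict Γ) ∧
    (∀ᵐ x ∂((μHE[n - 1] : Measure (Eu (n + 1))).restrict Γ), ‖ν' x‖ = 1) ∧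
    ∀ X, IsTangential X →
      (∫ x in T, ψ₂ x * divAlong (wall n) X x ∂μHE[n]) =
        ∫ x in Γ, ψ₃ x * inner ℝ (X x) (ν' x) ∂μHE[n - 1]

end

end CapillaryCone

open CapillaryCone

/-!
Write `E` for the vertical unit vector, `c = ν · E = -cos α`, and let `P` be the projection onto the
wall. If `α < π / 2` there is nothing to prove, so assume `c ≥ 0`.

Take the test function `η = ((R² - |x|²)₊)²`, whose gradient is `-4 (R² - |x|²)₊ x`. A cone contains
the radial direction in almost every tangent plane (`IsRectifiableCone.ae_mem_tangentPlane`), so the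
divergence of `η v` along `M` is `-4 (R² - |x|²)₊ (x · v)`, with no trace of the tangent plane left;
the same holds along `T`. With
`a(v) = ∫_M ψ₁ (R² - |x|²)₊ (x · v)`, `b(v) = ∫_T ψ₂ (R² - |x|²)₊ (x · v)`, `G = ∫_Γ ψ₃ η`,
the first variation gives `4 a(v) - 4 cos θ b(v) = sin θ (v · E) G` whenever `v · E ≥ 0`
(`IsStationaryTriple.radial_identity`), and the conormal gives `4 |b(v)| ≤ |P v| G`
(`IsStationaryTriple.abs_wetted_le`). For `v = ν` one has `|P ν| = sin α`, and as `cos θ ≤ 0`,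

  `0 ≥ 4 a(ν) ≥ (c sin θ + cos θ sin α) G = sin (α - θ) G`,

where the first inequality is `M ⊆ H⁻`.

If `α > θ`, then `G = 0` for every `R`, so `Γ = ∅`, and both `a(ν)` and `a(E)` vanish. Since the
integrands have a sign, `M` lies in `ν^⟂` and in the wall. As `Γ = ∅` excludes `ν = E`, these
hyperplanes are transversal, so `M` is `ℋⁿ`-null, and a normalized null set is empty.

If `α = θ`, then `a(ν) = 0` for every `R`, so `M ⊆ ν^⟂`, which is transversal to the wall. There a
constancy argument applies (`IsStationaryTriple.notMem_of_notMem`): inside the open half-space, the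
integral `∫_M ψ₁ η(· - p)` has zero derivative in `p` along `ν^⟂`, so it vanishes either for all
small bumps or for none. Hence `M` is the whole half-hyperplane
(`IsStationaryTriple.eq_halfHyperplane`).
-/

namespace CapillaryCone

open MeasureTheory Measure Set Module
open scoped NNReal ENNReal

/-! ### Cones contain the radial direction in their tangent planes -/

/-- A map that is differentiable with injective derivative at every point of `S` does not collapse
the top-dimensional Hausdorff measure of `S`. -/
theorem hausdorffMeasure_eq_zero_of_image {E : Type*} [NormedAddCommGroup E] [NormedSpace ℝ E]
    [FiniteDimensional ℝ E] [MeasurableSpace E] [BorelSpace E] {m : ℕ} {F : E → Eu m} {S : Set E}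
    {F' : E → E →L[ℝ] Eu m} (hF : ∀ x ∈ S, HasFDerivAt F (F' x) x)
    (hinj : ∀ x ∈ S, Function.Injective (F' x)) {d : ℝ} (hd : 0 ≤ d) (h0 : μH[d] (F '' S) = 0) :
    μH[d] S = 0 := by
  -- half of the expansion `2 * c` of `A` survives an approximation error of slope `c`
  have hA : ∀ A : E →L[ℝ] Eu m, ∃ c : ℝ≥0, c ≠ 0 ∧
      (Function.Injective A → ∀ z, 2 * c * ‖z‖ ≤ ‖A z‖) := by
    intro A
    by_cases hi : Function.Injective A
    · obtain ⟨C, hC, hanti⟩ := LinearMap.exists_antilipschitzWith (A : E →ₗ[ℝ] Eu m)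
        (LinearMap.ker_eq_bot.2 hi)
      refine ⟨(2 * C)⁻¹, by positivity, fun _ z => ?_⟩
      have := hanti.le_mul_dist z 0
      simp only [dist_zero_right, map_zero, ContinuousLinearMap.coe_coe] at this
      have hC' : (0:ℝ) < C := hC
      push_cast
      rw [show (2:ℝ) * (2 * (C:ℝ))⁻¹ * ‖z‖ = ‖z‖ / C by field_simp, div_le_iff₀ hC']
      linarith
    · exact ⟨1, one_ne_zero, fun h => absurd h hi⟩
  choose r hr0 hr using hA
  obtain ⟨t, A, -, hcov, happ, hAy⟩ := exists_closed_cover_approximatesLinearOn_of_hasFDerivWithinAt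
    F S F' (fun x hx => (hF x hx).hasFDerivWithinAt) r hr0
  have piece : ∀ n, μH[d] (S ∩ t n) = 0 := by
    intro n
    have hr' : (0 : ℝ) < r (A n) := lt_of_le_of_ne (r (A n)).2 (by exact_mod_cast (hr0 (A n)).symm)
    have hanti : AntilipschitzWith (r (A n))⁻¹ ((S ∩ t n).domRestrict F) := by
      refine AntilipschitzWith.of_le_mul_dist ?_
      rintro ⟨v, hv⟩ ⟨v', hv'⟩
      obtain ⟨y, hy, hAny⟩ := hAy ⟨v, hv.1⟩ n
      have h1 := hr (A n) (hAny ▸ hinj y hy) (v - v')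
      have h2 := happ n v hv v' hv'
      have h3 : ‖A n (v - v')‖ ≤ ‖F v - F v' - A n (v - v')‖ + ‖F v - F v'‖ := by
        have := norm_sub_le (F v - F v') (F v - F v' - A n (v - v'))
        simpa [add_comm] using this
      rw [Subtype.dist_eq, dist_eq_norm, dist_eq_norm]
      push_cast
      rw [inv_mul_eq_div, le_div_iff₀ hr', domRestrict_apply, domRestrict_apply]
      linarith
    have h1 := hanti.le_hausdorffMeasure_image hd univ
    have h2 : μH[d] ((S ∩ t n).domRestrict F '' univ) = 0 := by
      refine measure_mono_null ?_ h0
      rw [image_univ, range_domRestrict]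
      exact image_mono inter_subset_left
    rw [h2, mul_zero] at h1
    have h3 := (isometry_subtype_coe (s := S ∩ t n)).hausdorffMeasure_image (Or.inl hd) univ
    rw [image_univ, Subtype.range_coe] at h3
    rw [h3]
    exact nonpos_iff_eq_zero.1 h1
  refine measure_mono_null (fun x hx => ?_) (measure_iUnion_null piece)
  obtain ⟨n, hn⟩ := mem_iUnion.1 (hcov hx)
  exact mem_iUnion.2 ⟨n, hx, hn⟩

theorem euclideanHausdorffMeasure_eq_zero_iff {m : ℕ} (k : ℕ) (s : Set (Eu m)) :
    μHE[k] s = 0 ↔ μH[(k : ℝ)] s = 0 := by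
  rw [euclideanHausdorffMeasure_def, Measure.smul_apply, smul_eq_zero_iff_right]
  exact (addHaarScalarFactor_pos_of_isAddHaarMeasure _ _).ne'

theorem IsLocallyRectifiable.hausdorffMeasure_succ_eq_zero {k m : ℕ} {M : Set (Eu m)}
    (hM : IsLocallyRectifiable k M) : μH[(k : ℝ) + 1] M = 0 := by
  obtain ⟨g, hg, hcov⟩ := hM.exists_cover
  rw [euclideanHausdorffMeasure_eq_zero_iff] at hcov
  have h1 : μH[(k : ℝ) + 1] (M \ ⋃ i, range (g i)) = 0 :=
    nonpos_iff_eq_zero.1 (hcov ▸ hausdorffMeasure_mono (by linarith) _)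
  have h2 : ∀ i, μH[(k : ℝ) + 1] (range (g i)) = 0 := by
    intro i
    obtain ⟨K, hK⟩ := hg i
    have : dimH (range (g i)) < ((k + 1 : ℝ≥0) : ℝ≥0∞) := by
      refine hK.dimH_range_le.trans_lt ?_
      rw [Real.dimH_univ_eq_finrank, finrank_euclideanSpace_fin]
      exact_mod_cast Nat.lt_succ_self k
    exact_mod_cast hausdorffMeasure_of_dimH_lt this
  refine measure_mono_null (fun x hx => ?_) (measure_union_null h1 (measure_iUnion_null h2))
  by_cases h : x ∈ ⋃ i, range (g i)
  exacts [Or.inr h, Or.inl ⟨hx, h⟩]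

/-- At almost every point the tangent plane of a cone contains the position vector. Otherwise the
cone over a piece of `M`, which lies in `M`, would have dimension `k + 1`. -/
theorem IsRectifiableCone.ae_mem_tangentPlane {k m : ℕ} {M : Set (Eu m)} {ψ : Eu m → ℝ}
    (hM : IsRectifiableCone k M ψ) :
    ∀ᵐ x ∂((μHE[k] : Measure (Eu m)).restrict M), x ∈ tangentPlane k M x := by
  obtain ⟨g, hg, hcov⟩ := hM.rectifiable.exists_cover
  obtain ⟨hτ1, hτ2⟩ := hM.rectifiable.isTangentField_tangentPlane
  have hB : ∀ i, μHE[k] (g i '' {u | g i u ∈ M ∧ DifferentiableAt ℝ (g i) u ∧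
      Function.Injective (fderiv ℝ (g i) u) ∧ g i u ∉ (fderiv ℝ (g i) u).range}) = 0 := by
    intro i
    obtain ⟨K, hK⟩ := hg i
    refine null_image hK ?_
    set B := {u | g i u ∈ M ∧ DifferentiableAt ℝ (g i) u ∧
      Function.Injective (fderiv ℝ (g i) u) ∧ g i u ∉ (fderiv ℝ (g i) u).range}
    let F : ℝ × Eu k → Eu m := fun p => p.1 • g i p.2
    let F' : ℝ × Eu k → ℝ × Eu k →L[ℝ] Eu m := fun p =>
      p.1 • (fderiv ℝ (g i) p.2 ∘L ContinuousLinearMap.snd ℝ ℝ (Eu k)) +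
        (ContinuousLinearMap.fst ℝ ℝ (Eu k)).smulRight (g i p.2)
    have hF : ∀ p ∈ Ioi (0 : ℝ) ×ˢ B, HasFDerivAt F (F' p) p := by
      rintro ⟨s, u⟩ ⟨-, -, hd, -⟩
      have h1 : HasFDerivAt (fun p : ℝ × Eu k => g i p.2) _ (s, u) :=
        HasFDerivAt.comp (s, u) (f := Prod.snd) (g := g i) hd.hasFDerivAt hasFDerivAt_snd
      exact (hasFDerivAt_fst (𝕜 := ℝ) (p := (s, u))).smul h1
    have hinj : ∀ p ∈ Ioi (0 : ℝ) ×ˢ B, Function.Injective (F' p) := by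
      rintro ⟨s, u⟩ ⟨hs, -, hd, hi, hn⟩
      rw [injective_iff_map_eq_zero]
      rintro ⟨σ, z⟩ h
      have h : s • fderiv ℝ (g i) u z + σ • g i u = 0 := h
      have hσ : σ = 0 := by
        by_contra hσ
        refine hn ⟨(-(σ⁻¹ * s)) • z, ?_⟩
        have e : g i u = σ⁻¹ • (σ • g i u) := by rw [smul_smul, inv_mul_cancel₀ hσ, one_smul]
        rw [e, eq_neg_of_add_eq_zero_right h]
        simp [mul_smul]
      have hz : fderiv ℝ (g i) u z = 0 := by
        have hs : s ≠ 0 := ne_of_gt hs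
        simpa [hσ, hs] using h
      rw [hσ, (injective_iff_map_eq_zero _).1 hi z hz]
      rfl
    have hsub : F '' (Ioi (0 : ℝ) ×ˢ B) ⊆ M := by
      rintro _ ⟨⟨s, u⟩, ⟨hs, hu⟩, rfl⟩
      rw [← hM.cone s hs]
      exact mem_image_of_mem _ hu.1
    have hS := hausdorffMeasure_eq_zero_of_image hF hinj (d := (k : ℝ) + 1) (by positivity)
      (measure_mono_null hsub hM.rectifiable.hausdorffMeasure_succ_eq_zero)
    have hHaar : (μH[(k : ℝ) + 1] : Measure (ℝ × Eu k)).IsAddHaarMeasure := by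
      have e : (k : ℝ) + 1 = (finrank ℝ (ℝ × Eu k) : ℝ) := by simp [add_comm]
      rw [e]
      exact MeasureTheory.isAddHaarMeasure_hausdorffMeasure
    have hv : (volume : Measure ℝ).prod (volume : Measure (Eu k)) (Ioi (0 : ℝ) ×ˢ B) = 0 :=
      absolutelyContinuous_isAddHaarMeasure _ (μH[(k : ℝ) + 1] : Measure (ℝ × Eu k)) hS
    rw [Measure.prod_prod] at hv
    simpa using hv
  have hcov' : ∀ᵐ x ∂((μHE[k] : Measure (Eu m)).restrict M), x ∈ ⋃ i, range (g i) := by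
    rw [ae_restrict_iff' hM.rectifiable.measurableSet]
    filter_upwards [compl_mem_ae_iff.2 hcov] with x hx hxM
    by_contra hc
    exact hx ⟨hxM, hc⟩
  filter_upwards [hτ1, ae_all_iff.2 fun i => hτ2 (g i) (hg i), hcov',
    ae_restrict_of_ae (compl_mem_ae_iff.2 (measure_iUnion_null hB)),
    ae_restrict_mem hM.rectifiable.measurableSet] with x h1 h2 h3 h4 h5
  obtain ⟨i, u, rfl⟩ := mem_iUnion.1 h3
  obtain ⟨hd, hr⟩ := h2 i u rfl
  by_contra hn
  refine h4 (mem_iUnion.2 ⟨i, u, ⟨h5, hd, ?_, hr ▸ hn⟩, rfl⟩)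
  refine LinearMap.ker_eq_bot.1 (Submodule.finrank_eq_zero.1 ?_)
  have := LinearMap.finrank_range_add_finrank_ker (fderiv ℝ (g i) u : Eu k →ₗ[ℝ] Eu m)
  rw [finrank_euclideanSpace_fin, show finrank ℝ (fderiv ℝ (g i) u : Eu k →ₗ[ℝ] Eu m).range = k
    from hr ▸ h1] at this
  omega

/-! ### Radial test functions -/

theorem hasDerivAt_max_zero_sq (t : ℝ) :
    HasDerivAt (fun t : ℝ => max 0 t ^ 2) (2 * max 0 t) t := by
  rcases lt_trichotomy t 0 with h | rfl | h
  · rw [max_eq_left h.le, mul_zero]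
    refine (hasDerivAt_const t (0 : ℝ)).congr_of_eventuallyEq ?_
    filter_upwards [gt_mem_nhds h] with s hs
    simp [max_eq_left hs.le]
  · rw [max_self, mul_zero, hasDerivAt_iff_isLittleO_nhds_zero]
    refine Asymptotics.IsBigO.trans_isLittleO (g := fun h : ℝ => h ^ 2) ?_ ?_
    · refine Asymptotics.IsBigO.of_bound 1 (Filter.Eventually.of_forall fun s => ?_)
      rcases le_total s 0 with hs | hs <;> simp [hs]
      positivity
    · simpa using Asymptotics.isLittleO_pow_id (𝕜 := ℝ) one_lt_two
  · rw [max_eq_right h.le]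
    have := hasDerivAt_pow 2 t
    refine HasDerivAt.congr_of_eventuallyEq (f := fun t : ℝ => t ^ 2) (by simpa using this) ?_
    filter_upwards [lt_mem_nhds h] with s hs
    simp [max_eq_right hs.le]

/-- The positive part of `R² - |x - p|²`, up to a factor the radial derivative of `bump p R`. -/
noncomputable def cap {m : ℕ} (p : Eu m) (R : ℝ) (x : Eu m) : ℝ := max 0 (R ^ 2 - ‖x - p‖ ^ 2)

/-- The test function `((R² - |x - p|²)₊)²`: it is `C¹`, positive exactly on the open ball of
radius `R` about `p`, and radially decreasing. -/
noncomputable def bump {m : ℕ} (p : Eu m) (R : ℝ) (x : Eu m) : ℝ := cap p R x ^ 2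

variable {m : ℕ} {p : Eu m} {R : ℝ}

theorem cap_nonneg (x : Eu m) : 0 ≤ cap p R x := le_max_left _ _

theorem cap_pos (hR : 0 < R) {x : Eu m} (hx : x ∈ Metric.ball p R) : 0 < cap p R x := by
  rw [mem_ball_iff_norm] at hx
  refine lt_max_of_lt_right ?_
  have := norm_nonneg (x - p)
  nlinarith

theorem cap_eq_zero (hR : 0 ≤ R) {x : Eu m} (hx : R ≤ ‖x - p‖) : cap p R x = 0 :=
  max_eq_left (by nlinarith)

theorem cap_le_sq (x : Eu m) : cap p R x ≤ R ^ 2 :=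
  max_le (by positivity) (by nlinarith [norm_nonneg (x - p)])

theorem continuous_cap : Continuous (cap p R) := by unfold cap; fun_prop

theorem continuous_bump : Continuous (bump p R) := continuous_cap.pow 2

theorem bump_nonneg (x : Eu m) : 0 ≤ bump p R x := sq_nonneg _

theorem hasCompactSupport_cap (hR : 0 ≤ R) : HasCompactSupport (cap p R) := by
  refine HasCompactSupport.intro (isCompact_closedBall p R) fun x hx => cap_eq_zero hR ?_
  rw [mem_closedBall_iff_norm, not_le] at hx
  exact hx.le

theorem hasCompactSupport_bump (hR : 0 ≤ R) : HasCompactSupport (bump p R) :=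
  (hasCompactSupport_cap hR).comp_left (g := fun t => t ^ 2) (by simp)

theorem hasFDerivAt_bump (x : Eu m) :
    HasFDerivAt (bump p R) ((-4 * cap p R x) • innerSL ℝ (x - p)) x := by
  have h1 : HasFDerivAt (fun x : Eu m => R ^ 2 - ‖x - p‖ ^ 2) (-((2 : ℝ) • innerSL ℝ (x - p))) x := by
    have := ((hasFDerivAt_id x).sub_const p).norm_sq.const_sub (R ^ 2)
    refine this.congr_fderiv ?_
    ext z
    simp
  have h2 := (hasDerivAt_max_zero_sq (R ^ 2 - ‖x - p‖ ^ 2)).comp_hasFDerivAt x h1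
  refine h2.congr_fderiv ?_
  rw [smul_neg, smul_smul, ← neg_smul, cap]
  congr 1
  ring

theorem contDiff_bump : ContDiff ℝ 1 (bump p R) := by
  rw [contDiff_one_iff_hasFDerivAt]
  refine ⟨_, ?_, hasFDerivAt_bump⟩
  have := continuous_cap (p := p) (R := R)
  fun_prop

theorem divAlong_bump (π : Submodule ℝ (Eu m)) (v x : Eu m) :
    divAlong π (fun x => bump p R x • v) x =
      -4 * cap p R x * inner ℝ (x - p) (π.starProjection v) := by
  have h : fderiv ℝ (fun x => bump p R x • v) x =
      ((-4 * cap p R x) • innerSL ℝ (x - p)).smulRight v :=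
    ((hasFDerivAt_bump x).smul_const v).fderiv
  rw [divAlong, h]
  have e : (π.starProjection ∘L ((-4 * cap p R x) • innerSL ℝ (x - p)).smulRight v :
      Eu m →L[ℝ] Eu m).toLinearMap =
      (((-4 * cap p R x) • innerSL ℝ (x - p) : Eu m →L[ℝ] ℝ).toLinearMap).smulRight
        (π.starProjection v) := by
    ext z
    simp
  rw [e, LinearMap.trace_smulRight]
  simp [-map_sub]

/-! ### The wall and admissible bumps -/

variable {n : ℕ}

theorem mem_wall_iff {x : Eu (n + 1)} : x ∈ wall n ↔ inner ℝ x (vertical n) = 0 := by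
  rw [wall, Submodule.mem_orthogonal_singleton_iff_inner_left]

theorem inner_vertical (x : Eu (n + 1)) : inner ℝ x (vertical n) = x (Fin.last n) := by
  rw [vertical, EuclideanSpace.inner_single_right]
  simp

theorem norm_vertical : ‖vertical n‖ = 1 := by simp [vertical]

theorem mem_upperHalfSpace_iff {x : Eu (n + 1)} :
    x ∈ upperHalfSpace n ↔ 0 ≤ inner ℝ x (vertical n) := by
  rw [inner_vertical]; rfl

theorem isAdmissible_bump {p : Eu (n + 1)} (hR : 0 ≤ R) {v : Eu (n + 1)}
    (h : ∀ x ∈ wall n, bump p R x ≠ 0 → 0 ≤ inner ℝ v (vertical n)) :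
    IsAdmissible fun x => bump p R x • v where
  contDiff := contDiff_bump.smul contDiff_const
  hasCompactSupport := (hasCompactSupport_bump hR).smul_right
  mem_tangentCone x hx := by
    rw [mem_upperHalfSpace_iff, inner_smul_left]
    by_cases h0 : bump p R x = 0
    · simp [h0]
    · exact mul_nonneg (bump_nonneg x) (h x hx h0)

theorem isTangential_bump {p : Eu (n + 1)} (hR : 0 ≤ R) {v : Eu (n + 1)} (hv : v ∈ wall n) :
    IsTangential fun x => bump p R x • v where
  toIsAdmissible := isAdmissible_bump hR fun _ _ _ => (mem_wall_iff.1 hv).ge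
  mem_wall _ _ := (wall n).smul_mem _ hv

/-! ### Normalized sets -/

theorem IsNormalized.inter_eq_empty {k : ℕ} {M : Set (Eu m)} (hM : IsNormalized k M)
    {U : Set (Eu m)} (hU : IsOpen U) (h0 : μHE[k] (U ∩ M) = 0) : U ∩ M = ∅ := by
  rw [eq_empty_iff_forall_notMem]
  rintro x ⟨hxU, hxM⟩
  obtain ⟨ρ, hρ, hb⟩ := Metric.isOpen_iff.1 hU x hxU
  exact ((hM x).1 hxM ρ hρ).ne' (measure_mono_null (inter_subset_inter_left _ hb) h0)

theorem IsNormalized.isClosed {k : ℕ} {M : Set (Eu m)} (hM : IsNormalized k M) : IsClosed M := by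
  refine isClosed_of_closure_subset fun x hx => (hM x).2 fun ρ hρ => ?_
  obtain ⟨y, hy, hxy⟩ := Metric.mem_closure_iff.1 hx (ρ / 2) (half_pos hρ)
  refine ((hM y).1 hy (ρ / 2) (half_pos hρ)).trans_le (measure_mono (inter_subset_inter_left _ ?_))
  refine Metric.ball_subset_ball' ?_
  rw [dist_comm] at hxy
  linarith

/-- If a positive density on `M` has zero weighted integral against `f ≥ 0`, then `M` does not
meet the open set where `f` is positive. -/
theorem IsRectifiableCone.inter_eq_empty_of_integral_eq_zero {k : ℕ} {M : Set (Eu m)}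
    {ψ : Eu m → ℝ} (hM : IsRectifiableCone k M ψ) {f : Eu m → ℝ} (hf : ∀ x ∈ M, 0 ≤ f x)
    (hint : IntegrableOn (fun x => ψ x * f x) M μHE[k])
    (h0 : ∫ x in M, ψ x * f x ∂μHE[k] = 0) {U : Set (Eu m)} (hU : IsOpen U)
    (hpos : ∀ x ∈ U ∩ M, 0 < f x) : U ∩ M = ∅ := by
  refine hM.normalized.inter_eq_empty hU ?_
  have hms := hM.rectifiable.measurableSet
  rw [integral_eq_zero_iff_of_nonneg_ae ?_ hint] at h0
  · rw [Filter.EventuallyEq, ae_restrict_iff' hms, ae_iff] at h0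
    refine measure_mono_null (fun x hx => ?_) h0
    have := mul_pos (hM.density_pos x hx.2) (hpos x hx)
    simp only [mem_ofPred_eq, Classical.not_imp]
    exact ⟨hx.2, this.ne'⟩
  · filter_upwards [ae_restrict_mem hms] with x hx
    exact mul_nonneg (hM.density_pos x hx).le (hf x hx)

theorem IsRectifiableCone.integrableOn_mul {k : ℕ} {M : Set (Eu m)}
    {ψ : Eu m → ℝ} (hM : IsRectifiableCone k M ψ) {f : Eu m → ℝ} (hf : Continuous f)
    (hc : HasCompactSupport f) : IntegrableOn (fun x => ψ x * f x) M μHE[k] := by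
  simpa [mul_comm] using! hM.density_locallyIntegrable.integrable_smul_left_of_hasCompactSupport hf hc

/-! ### Cones contained in a linear subspace -/

theorem IsRectifiableCone.eq_empty_of_subset {k : ℕ} {M : Set (Eu m)} {ψ : Eu m → ℝ}
    (hM : IsRectifiableCone k M ψ) {S : Submodule ℝ (Eu m)} (hS : finrank ℝ S < k)
    (hMS : M ⊆ S) : M = ∅ := by
  have h1 : dimH (S : Set (Eu m)) < ((k : ℝ≥0) : ℝ≥0∞) := by
    have := (LipschitzWith.subtype_val (S : Set (Eu m))).dimH_range_le
    rw [Subtype.range_coe] at this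
    refine this.trans_lt ?_
    have e : dimH (univ : Set S) = finrank ℝ S := Real.dimH_univ_eq_finrank S
    refine e.trans_lt ?_
    exact_mod_cast hS
  have h2 : μHE[k] M = 0 := by
    rw [euclideanHausdorffMeasure_eq_zero_iff]
    exact measure_mono_null hMS (by exact_mod_cast hausdorffMeasure_of_dimH_lt h1)
  simpa using hM.normalized.inter_eq_empty isOpen_univ (by simpa using h2)

theorem IsLocallyRectifiable.ae_tangentPlane_eq {k : ℕ} {M : Set (Eu m)}
    (hM : IsLocallyRectifiable k M) {S : Submodule ℝ (Eu m)} (hS : finrank ℝ S = k)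
    (hMS : M ⊆ S) : ∀ᵐ x ∂((μHE[k] : Measure (Eu m)).restrict M), tangentPlane k M x = S := by
  let e : Eu k ≃ₗᵢ[ℝ] S := ((stdOrthonormalBasis ℝ S).reindex (finCongr hS)).repr.symm
  let g : Eu k →L[ℝ] Eu m := S.subtypeL ∘L (e : Eu k →L[ℝ] S)
  filter_upwards [hM.isTangentField_tangentPlane.2 g ⟨_, g.lipschitz⟩,
    ae_restrict_mem hM.measurableSet] with x hx hxM
  have hu : g (e.symm ⟨x, hMS hxM⟩) = x := by simp [g]
  rw [← (hx _ hu).2, ContinuousLinearMap.fderiv]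
  ext y
  constructor
  · rintro ⟨u, rfl⟩
    exact (e u).2
  · intro hy
    exact ⟨e.symm ⟨y, hy⟩, by simp [g]⟩

/-- A unit vector `v` that is not parallel to `E` has a vector `w ⟂ v` with `w · E > 0`. -/
theorem exists_inner_vertical_pos {v : Eu (n + 1)} (hv : ‖v‖ = 1)
    (hvE : inner ℝ v (vertical n) ^ 2 < 1) :
    ∃ w ∈ (ℝ ∙ v)ᗮ, 0 < inner ℝ w (vertical n) := by
  refine ⟨vertical n - inner ℝ v (vertical n) • v, ?_, ?_⟩
  · rw [Submodule.mem_orthogonal_singleton_iff_inner_right, inner_sub_right, inner_smul_right,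
      real_inner_self_eq_norm_sq, hv]
    ring
  · rw [inner_sub_left, inner_smul_left, real_inner_self_eq_norm_sq, norm_vertical]
    simp only [conj_trivial]
    nlinarith

theorem finrank_orthogonal_singleton {v : Eu (n + 1)} (hv : ‖v‖ = 1) :
    finrank ℝ (ℝ ∙ v)ᗮ = n := by
  have : Fact (finrank ℝ (Eu (n + 1)) = n + 1) := ⟨by simp⟩
  exact Submodule.finrank_orthogonal_span_singleton (by rintro rfl; simp at hv)

theorem IsRectifiableCone.not_subset_wall {M : Set (Eu (n + 1))} {ψ : Eu (n + 1) → ℝ}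
    (hM : IsRectifiableCone n M ψ) (hne : M.Nonempty) {v : Eu (n + 1)} (hv : ‖v‖ = 1)
    (hvE : inner ℝ v (vertical n) ^ 2 < 1) (hMv : M ⊆ (ℝ ∙ v)ᗮ) : ¬ M ⊆ wall n := by
  intro hMw
  obtain ⟨w, hw, hwE⟩ := exists_inner_vertical_pos hv hvE
  have hlt : (ℝ ∙ v)ᗮ ⊓ wall n < (ℝ ∙ v)ᗮ :=
    lt_of_le_of_ne inf_le_left fun h => hwE.ne' (mem_wall_iff.1 (inf_eq_left.1 h hw))
  have := Submodule.finrank_lt_finrank_of_lt hlt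
  rw [finrank_orthogonal_singleton hv] at this
  exact hne.ne_empty (hM.eq_empty_of_subset this fun x hx => ⟨hMv hx, hMw hx⟩)

/-! ### The first variation on radial test functions -/

/-- A cone on the nonnegative side of `v^⟂` whose weighted first moment in direction `v` vanishes lies
in `v^⟂`. -/
theorem IsRectifiableCone.subset_orthogonal {k : ℕ} {M : Set (Eu m)} {ψ : Eu m → ℝ}
    (hM : IsRectifiableCone k M ψ) {v : Eu m} (hv : ∀ x ∈ M, 0 ≤ inner ℝ x v)
    (h0 : ∀ R > 0, ∫ x in M, ψ x * (cap 0 R x * inner ℝ x v) ∂μHE[k] = 0) :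
    M ⊆ (ℝ ∙ v)ᗮ := by
  intro x hx
  rw [SetLike.mem_coe, Submodule.mem_orthogonal_singleton_iff_inner_left]
  by_contra hne
  have hpos : 0 < inner ℝ x v := lt_of_le_of_ne (hv x hx) (Ne.symm hne)
  have hR : 0 < ‖x‖ + 1 := by positivity
  have hc := continuous_cap (p := (0 : Eu m)) (R := ‖x‖ + 1)
  have hU : IsOpen (Metric.ball (0 : Eu m) (‖x‖ + 1) ∩ {y | 0 < inner ℝ y v}) :=
    Metric.isOpen_ball.inter (isOpen_lt continuous_const (by fun_prop))
  have := hM.inter_eq_empty_of_integral_eq_zero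
    (fun y hy => mul_nonneg (cap_nonneg y) (hv y hy))
    (hM.integrableOn_mul (by fun_prop) (hasCompactSupport_cap hR.le).mul_right) (h0 _ hR) hU
    (fun y hy => mul_pos (cap_pos hR hy.1.1) hy.1.2)
  exact this.subset ⟨⟨by simp, hpos⟩, hx⟩

variable {θ : ℝ} {M T Γ : Set (Eu (n + 1))} {ψ₁ ψ₂ ψ₃ : Eu (n + 1) → ℝ}

/-- The first variation identity for `X = bump 0 R • v`. Since `M` and `T` are cones, `div X` only
sees the radial derivative of the bump. -/
theorem IsStationaryTriple.radial_identity (hM : IsRectifiableCone n M ψ₁)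
    (hT : IsRectifiableCone n T ψ₂) (hT_sub : T ⊆ wall n)
    (hstat : IsStationaryTriple θ M T Γ ψ₁ ψ₂ ψ₃) {R : ℝ} (hR : 0 ≤ R) {v : Eu (n + 1)}
    (hv : 0 ≤ inner ℝ v (vertical n)) :
    4 * (∫ x in M, ψ₁ x * (cap 0 R x * inner ℝ x v) ∂μHE[n]) +
      4 * Real.cos (Real.pi - θ) * (∫ x in T, ψ₂ x * (cap 0 R x * inner ℝ x v) ∂μHE[n]) =
    Real.sin θ * inner ℝ v (vertical n) * ∫ x in Γ, ψ₃ x * bump 0 R x ∂μHE[n - 1] := by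
  have h := hstat.firstVariation _ (isAdmissible_bump (p := 0) hR fun _ _ _ => hv)
  have h1 : ∫ x in M, ψ₁ x * divAlong (tangentPlane n M x) (fun x => bump 0 R x • v) x ∂μHE[n] =
      -4 * ∫ x in M, ψ₁ x * (cap 0 R x * inner ℝ x v) ∂μHE[n] := by
    rw [← integral_const_mul]
    refine integral_congr_ae ?_
    filter_upwards [hM.ae_mem_tangentPlane] with x hx
    rw [divAlong_bump, sub_zero, ← Submodule.inner_starProjection_left_eq_right,
      Submodule.starProjection_eq_self_iff.2 hx]
    ring
  have h2 : ∫ x in T, ψ₂ x * divAlong (wall n) (fun x => bump 0 R x • v) x ∂μHE[n] =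
      -4 * ∫ x in T, ψ₂ x * (cap 0 R x * inner ℝ x v) ∂μHE[n] := by
    rw [← integral_const_mul]
    refine integral_congr_ae ?_
    filter_upwards [ae_restrict_mem hT.rectifiable.measurableSet] with x hx
    rw [divAlong_bump, sub_zero, ← Submodule.inner_starProjection_left_eq_right,
      Submodule.starProjection_eq_self_iff.2 (hT_sub hx)]
    ring
  have h3 : ∫ x in Γ, ψ₃ x * inner ℝ (bump 0 R x • v) (vertical n) ∂μHE[n - 1] =
      inner ℝ v (vertical n) * ∫ x in Γ, ψ₃ x * bump 0 R x ∂μHE[n - 1] := by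
    rw [← integral_const_mul]
    congr 1 with x
    rw [inner_smul_left]
    simp only [conj_trivial]
    ring
  rw [h1, h2, h3] at h
  linarith

/-- The existence of a unit conormal bounds the wetted term by the mass of `Γ`. -/
theorem IsStationaryTriple.abs_wetted_le (hT : IsRectifiableCone n T ψ₂)
    (hΓ : IsRectifiableCone (n - 1) Γ ψ₃) (hT_sub : T ⊆ wall n)
    (hstat : IsStationaryTriple θ M T Γ ψ₁ ψ₂ ψ₃) {R : ℝ} (hR : 0 ≤ R) (v : Eu (n + 1)) :
    |4 * ∫ x in T, ψ₂ x * (cap 0 R x * inner ℝ x v) ∂μHE[n]| ≤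
      ‖(wall n).starProjection v‖ * ∫ x in Γ, ψ₃ x * bump 0 R x ∂μHE[n - 1] := by
  obtain ⟨ν', -, hν1, hν'⟩ := hstat.exists_conormal
  set w := (wall n).starProjection v
  have hw : w ∈ wall n := Submodule.starProjection_apply_mem _ v
  have h := hν' _ (isTangential_bump (p := 0) hR hw)
  have h2 : ∫ x in T, ψ₂ x * divAlong (wall n) (fun x => bump 0 R x • w) x ∂μHE[n] =
      -(4 * ∫ x in T, ψ₂ x * (cap 0 R x * inner ℝ x v) ∂μHE[n]) := by
    rw [← integral_const_mul, ← integral_neg]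
    refine integral_congr_ae ?_
    filter_upwards [ae_restrict_mem hT.rectifiable.measurableSet] with x hx
    rw [divAlong_bump, sub_zero, Submodule.starProjection_eq_self_iff.2 hw,
      ← Submodule.inner_starProjection_left_eq_right,
      Submodule.starProjection_eq_self_iff.2 (hT_sub hx)]
    ring
  rw [h2] at h
  rw [← abs_neg, h, ← Real.norm_eq_abs, ← integral_const_mul]
  refine norm_integral_le_of_norm_le ((hΓ.integrableOn_mul continuous_bump
    (hasCompactSupport_bump hR)).const_mul _) ?_
  filter_upwards [hν1, ae_restrict_mem hΓ.rectifiable.measurableSet] with x hx hxΓ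
  rw [inner_smul_left, norm_mul, norm_mul, Real.norm_of_nonneg (hΓ.density_pos x hxΓ).le]
  simp only [conj_trivial]
  rw [Real.norm_of_nonneg (bump_nonneg x)]
  have h3 : ‖inner ℝ w (ν' x)‖ ≤ ‖w‖ := by simpa [hx] using norm_inner_le_norm (𝕜 := ℝ) w (ν' x)
  have h4 := mul_le_mul_of_nonneg_left h3
    (mul_nonneg (hΓ.density_pos x hxΓ).le (bump_nonneg (p := 0) (R := R) x))
  linarith

theorem norm_sq_starProjection_wall (v : Eu (n + 1)) (hv : ‖v‖ = 1) :
    ‖(wall n).starProjection v‖ ^ 2 = 1 - inner ℝ v (vertical n) ^ 2 := by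
  have h := Submodule.norm_sq_eq_add_norm_sq_starProjection v (ℝ ∙ vertical n)
  have h2 : (ℝ ∙ vertical n).starProjection v = inner ℝ (vertical n) v • vertical n :=
    Submodule.starProjection_unit_singleton ℝ norm_vertical v
  rw [h2, norm_smul, norm_vertical, hv, mul_one, Real.norm_eq_abs, sq_abs, real_inner_comm] at h
  rw [wall]
  linarith

/-! ### Sliding bumps along a hyperplane -/

/-- A radial function of `x - p` is symmetric in `x` and `p`, so the derivative of the bump in `x`
also gives the derivative in its centre. -/
theorem cap_comm (p x : Eu m) (R : ℝ) : cap p R x = cap x R p := by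
  rw [cap, cap, norm_sub_rev]

theorem bump_comm (p x : Eu m) (R : ℝ) : bump p R x = bump x R p := by
  rw [bump, bump, cap_comm]

theorem IsRectifiableCone.hasDerivAt_integral_bump {k : ℕ} {M : Set (Eu m)} {ψ : Eu m → ℝ}
    (hM : IsRectifiableCone k M ψ) (p w : Eu m) {R : ℝ} (hR : 0 ≤ R) (t : ℝ) :
    HasDerivAt (fun t : ℝ => ∫ x in M, ψ x * bump (p + t • w) R x ∂μHE[k])
      (∫ x in M, ψ x * (4 * cap (p + t • w) R x * inner ℝ (x - (p + t • w)) w) ∂μHE[k]) t := by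
  -- for `|s - t| < 1` the bumps centred at `p + s • w` are supported in the ball of radius `R' - 1`
  -- about `p`, on which `cap p R' ≥ 1`
  let R' : ℝ := R + (|t| + 1) * ‖w‖ + 1
  have hR' : 1 ≤ R' := by simp only [R']; nlinarith [abs_nonneg t, norm_nonneg w]
  have hint' : IntegrableOn (fun x => ψ x * (4 * R ^ 2 * (R * ‖w‖) * cap p R' x)) M μHE[k] :=
    hM.integrableOn_mul (continuous_const.mul continuous_cap)
      (hasCompactSupport_cap (by linarith)).mul_left
  have hcap : ∀ q : Eu m, Continuous (cap q R) := fun q => continuous_cap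
  refine (hasDerivAt_integral_of_dominated_loc_of_deriv_le
    (F := fun (t : ℝ) x => ψ x * bump (p + t • w) R x)
    (F' := fun (t : ℝ) x => ψ x * (4 * cap (p + t • w) R x * inner ℝ (x - (p + t • w)) w))
    (Metric.ball_mem_nhds t one_pos) ?_ ?_ ?_ ?_ hint'.norm ?_).2
  · exact .of_forall fun s =>
      (hM.integrableOn_mul continuous_bump (hasCompactSupport_bump hR)).aestronglyMeasurable
  · exact hM.integrableOn_mul continuous_bump (hasCompactSupport_bump hR)
  · refine (hM.integrableOn_mul ?_ ?_).aestronglyMeasurable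
    · have := hcap (p + t • w)
      fun_prop
    · exact ((hasCompactSupport_cap (p := p + t • w) hR).mul_left (f := fun _ => (4 : ℝ))).mul_right
  · refine .of_forall fun x s hs => ?_
    rw [norm_mul (ψ x), norm_mul (ψ x)]
    refine mul_le_mul_of_nonneg_left ?_ (norm_nonneg (ψ x))
    have hb : 0 ≤ 4 * R ^ 2 * (R * ‖w‖) * cap p R' x :=
      mul_nonneg (by positivity) (cap_nonneg x)
    rw [Real.norm_of_nonneg hb]
    rcases le_or_gt R ‖x - (p + s • w)‖ with h | h
    · rw [cap_eq_zero hR h]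
      simpa using hb
    · have hs' : |s| ≤ |t| + 1 := by
        rw [Metric.mem_ball, Real.dist_eq] at hs
        have := abs_sub_abs_le_abs_sub s t
        linarith
      have h1 : ‖x - p‖ ≤ R' - 1 := by
        have e : x - p = (x - (p + s • w)) + s • w := by abel
        have h2 := norm_add_le (x - (p + s • w)) (s • w)
        rw [← e, norm_smul, Real.norm_eq_abs] at h2
        have := mul_le_mul_of_nonneg_right hs' (norm_nonneg w)
        simp only [R']
        linarith
      have h3 : 1 ≤ cap p R' x :=
        le_max_of_le_right (by nlinarith [norm_nonneg (x - p)])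
      have h4 : |inner ℝ (x - (p + s • w)) w| ≤ R * ‖w‖ :=
        (abs_real_inner_le_norm _ _).trans (by gcongr)
      have h5 : |4 * cap (p + s • w) R x| ≤ 4 * R ^ 2 := by
        rw [abs_of_nonneg (mul_nonneg (by norm_num) (cap_nonneg x))]
        linarith [cap_le_sq (p := p + s • w) (R := R) x]
      rw [norm_mul, Real.norm_eq_abs, Real.norm_eq_abs]
      calc |4 * cap (p + s • w) R x| * |inner ℝ (x - (p + s • w)) w|
          ≤ 4 * R ^ 2 * (R * ‖w‖) := by gcongr
        _ ≤ _ := le_mul_of_one_le_right (by positivity) h3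
  · refine .of_forall fun x s _ => ?_
    have h1 : HasDerivAt (fun s : ℝ => p + s • w) w s := by
      simpa using ((hasDerivAt_id s).smul_const w).const_add p
    have h2 := ((hasFDerivAt_bump (p := x) (R := R) (p + s • w)).comp_hasDerivAt s h1).const_mul
      (ψ x)
    refine (h2.congr_deriv ?_).congr_of_eventuallyEq
      (.of_forall fun s => by simp only [bump_comm _ x, Function.comp_apply])
    rw [cap_comm _ x, ← neg_sub (p + s • w) x, inner_neg_left]
    simp only [_root_.smul_apply, innerSL_apply_apply, smul_eq_mul]
    ring

/-- The weighted mass that a bump centred on the hyperplane `v^⟂`, inside the open half-space, sees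
of a stationary `M ⊆ v^⟂` does not change as its centre moves; hence if a point of the open
half-hyperplane lies outside `M`, then so does every other one. -/
theorem IsStationaryTriple.notMem_of_notMem (hM : IsRectifiableCone n M ψ₁) (hT_sub : T ⊆ wall n)
    (hΓ_sub : Γ ⊆ wall n) (hstat : IsStationaryTriple θ M T Γ ψ₁ ψ₂ ψ₃) {v : Eu (n + 1)} (hv : ‖v‖ = 1)
    (hMv : M ⊆ (ℝ ∙ v)ᗮ) {p q : Eu (n + 1)} (hp : p ∈ (ℝ ∙ v)ᗮ) (hq : q ∈ (ℝ ∙ v)ᗮ)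
    (hpE : 0 < inner ℝ p (vertical n)) (hqE : 0 < inner ℝ q (vertical n)) (hpM : p ∉ M) :
    q ∉ M := by
  obtain ⟨r, hr, hrM⟩ := Metric.isOpen_iff.1 hM.normalized.isClosed.isOpen_compl p hpM
  obtain ⟨ρ, hρ, hρ'⟩ : ∃ ρ, 0 < ρ ∧ ρ ≤ r ∧ ρ ≤ inner ℝ p (vertical n) ∧
      ρ ≤ inner ℝ q (vertical n) :=
    ⟨min r (min (inner ℝ p (vertical n)) (inner ℝ q (vertical n))),
      lt_min hr (lt_min hpE hqE), min_le_left _ _, (min_le_right _ _).trans (min_le_left _ _),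
      (min_le_right _ _).trans (min_le_right _ _)⟩
  obtain ⟨hρr, hρp, hρq⟩ := hρ'
  set w := q - p
  have hw : w ∈ (ℝ ∙ v)ᗮ := Submodule.sub_mem _ hq hp
  -- the bumps centred on the segment from `p` to `q` vanish on the wall
  have hcap : ∀ t ∈ Icc (0 : ℝ) 1, ∀ x ∈ wall n, cap (p + t • w) ρ x = 0 := by
    intro t ht x hx
    refine cap_eq_zero hρ.le ?_
    have h1 := real_inner_le_norm ((p + t • w) - x) (vertical n)
    rw [norm_vertical, mul_one, norm_sub_rev, inner_sub_left, mem_wall_iff.1 hx, sub_zero,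
      inner_add_left, inner_smul_left, inner_sub_left] at h1
    simp only [conj_trivial] at h1
    nlinarith [ht.1, ht.2]
  have hconst : ∀ t ∈ Icc (0 : ℝ) 1, ∫ x in M, ψ₁ x * bump (p + t • w) ρ x ∂μHE[n] =
      ∫ x in M, ψ₁ x * bump (p + (0 : ℝ) • w) ρ x ∂μHE[n] := by
    refine constant_of_has_deriv_right_zero (fun t _ =>
      (hM.hasDerivAt_integral_bump p w hρ.le t).continuousAt.continuousWithinAt) fun t ht => ?_
    have ht' := Ico_subset_Icc_self ht
    have hbump : ∀ x ∈ wall n, bump (p + t • w) ρ x = 0 := fun x hx => by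
      rw [bump, hcap t ht' x hx]
      simp
    have h := hstat.firstVariation _ (isAdmissible_bump (p := p + t • w) (v := w) hρ.le
      fun x hx h0 => absurd (hbump x hx) h0)
    have h1 : ∫ x in M, ψ₁ x * divAlong (tangentPlane n M x)
        (fun x => bump (p + t • w) ρ x • w) x ∂μHE[n] =
        -∫ x in M, ψ₁ x * (4 * cap (p + t • w) ρ x * inner ℝ (x - (p + t • w)) w) ∂μHE[n] := by
      rw [← integral_neg]
      refine integral_congr_ae ?_
      filter_upwards [hM.rectifiable.ae_tangentPlane_eq (finrank_orthogonal_singleton hv) hMv]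
        with x hx
      rw [divAlong_bump, hx, Submodule.starProjection_eq_self_iff.2 hw]
      ring
    have h2 : ∫ x in T, ψ₂ x * divAlong (wall n) (fun x => bump (p + t • w) ρ x • w) x ∂μHE[n] =
        0 := by
      refine setIntegral_eq_zero_of_forall_eq_zero fun x hx => ?_
      rw [divAlong_bump, hcap t ht' x (hT_sub hx)]
      ring
    have h3 : ∫ x in Γ, ψ₃ x * inner ℝ (bump (p + t • w) ρ x • w) (vertical n) ∂μHE[n - 1] =
        0 := by
      refine setIntegral_eq_zero_of_forall_eq_zero fun x hx => ?_
      rw [hbump x (hΓ_sub hx)]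
      simp
    rw [h1, h2, h3, mul_zero, mul_zero, add_zero, neg_eq_zero] at h
    have := hM.hasDerivAt_integral_bump p w hρ.le t
    rw [h] at this
    exact this.hasDerivWithinAt
  have h0 : ∫ x in M, ψ₁ x * bump (p + (0 : ℝ) • w) ρ x ∂μHE[n] = 0 := by
    refine setIntegral_eq_zero_of_forall_eq_zero fun x hx => ?_
    have : ρ ≤ ‖x - (p + (0 : ℝ) • w)‖ := by
      rw [zero_smul, add_zero]
      by_contra hlt
      exact hrM (mem_ball_iff_norm.2 ((not_le.1 hlt).trans_le hρr)) hx
    rw [bump, cap_eq_zero hρ.le this]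
    ring
  have h1 := hconst 1 (right_mem_Icc.2 zero_le_one)
  rw [h0, one_smul, show p + w = q by simp [w]] at h1
  have := hM.inter_eq_empty_of_integral_eq_zero (fun x _ => bump_nonneg x)
    (hM.integrableOn_mul continuous_bump (hasCompactSupport_bump hρ.le)) h1
    Metric.isOpen_ball (fun x hx => pow_pos (cap_pos hρ hx.1) 2)
  exact fun hqM => this.subset ⟨Metric.mem_ball_self hρ, hqM⟩

/-- A constancy theorem: a nonempty stationary `M` inside the half-hyperplane bounded by the wall and
orthogonal to `v` is the whole half-hyperplane. -/
theorem IsStationaryTriple.eq_halfHyperplane (hM : IsRectifiableCone n M ψ₁)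
    (hM_sub : M ⊆ upperHalfSpace n) (hM_ne : M.Nonempty) (hT_sub : T ⊆ wall n)
    (hΓ_sub : Γ ⊆ wall n) (hstat : IsStationaryTriple θ M T Γ ψ₁ ψ₂ ψ₃) {v : Eu (n + 1)} (hv : ‖v‖ = 1)
    (hvE : inner ℝ v (vertical n) ^ 2 < 1) (hMv : M ⊆ (ℝ ∙ v)ᗮ) :
    M = {z | inner ℝ z v = 0} ∩ upperHalfSpace n := by
  obtain ⟨q, hqM, hq⟩ := not_subset.1 (hM.not_subset_wall hM_ne hv hvE hMv)
  have hqE : 0 < inner ℝ q (vertical n) :=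
    lt_of_le_of_ne (mem_upperHalfSpace_iff.1 (hM_sub hqM)) fun h => hq (mem_wall_iff.2 h.symm)
  have hopen : ∀ p ∈ (ℝ ∙ v)ᗮ, 0 < inner ℝ p (vertical n) → p ∈ M := by
    intro p hp hpE
    by_contra hpM
    exact hstat.notMem_of_notMem hM hT_sub hΓ_sub hv hMv hp (hMv hqM) hpE hqE hpM hqM
  refine Subset.antisymm (fun x hx => ⟨?_, hM_sub hx⟩) ?_
  · exact (Submodule.mem_orthogonal_singleton_iff_inner_left).1 (hMv hx)
  rintro x ⟨hxv, hxE⟩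
  have hlim : Filter.Tendsto (fun s : ℝ => x + s • q) (nhdsWithin 0 (Ioi 0)) (nhds x) := by
    have : Filter.Tendsto (fun s : ℝ => x + s • q) (nhds 0) (nhds (x + (0 : ℝ) • q)) :=
      Continuous.tendsto (by fun_prop) 0
    rw [zero_smul, add_zero] at this
    exact this.mono_left nhdsWithin_le_nhds
  refine hM.normalized.isClosed.mem_of_tendsto hlim ?_
  filter_upwards [self_mem_nhdsWithin] with s hs
  refine hopen _ (Submodule.add_mem _ (Submodule.mem_orthogonal_singleton_iff_inner_left.2 hxv)
    (Submodule.smul_mem _ _ (hMv hqM))) ?_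
  rw [inner_add_left, inner_smul_left]
  exact add_pos_of_nonneg_of_pos (mem_upperHalfSpace_iff.1 hxE) (mul_pos hs hqE)

theorem frontier_halfSpace_inner {v : Eu m} (hv : v ≠ 0) :
    frontier {z : Eu m | inner ℝ z v ≤ 0} = {z | inner ℝ z v = 0} := by
  have hsurj : Function.Surjective (innerSL ℝ v) := by
    refine LinearMap.surjective (f := (innerSL ℝ v : Eu m →ₗ[ℝ] ℝ)) fun h => hv ?_
    have h0 : inner ℝ v v = (0 : ℝ) := DFunLike.congr_fun h v
    exact inner_self_eq_zero.1 h0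
  have h := ((innerSL ℝ v).isOpenMap hsurj).preimage_frontier_eq_frontier_preimage
    (innerSL ℝ v).continuous (Iic 0)
  rw [frontier_Iic] at h
  have e : {z : Eu m | inner ℝ z v ≤ 0} = innerSL ℝ v ⁻¹' Iic 0 := by
    ext z; simp [real_inner_comm]
  rw [e, ← h]
  ext z
  simp [real_inner_comm]

end CapillaryCone

open CapillaryCone
theorem mainTheorem5 (n : ℕ) (hn : 1 ≤ n) (θ : ℝ) (hθ : θ ∈ Set.Ico (Real.pi / 2) Real.pi)
    (M T Γ : Set (Eu (n + 1))) (ψ₁ ψ₂ ψ₃ : Eu (n + 1) → ℝ)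
    (hM : IsRectifiableCone n M ψ₁) (hT : IsRectifiableCone n T ψ₂)
    (hΓ : IsRectifiableCone (n - 1) Γ ψ₃)
    (hM_sub : M ⊆ upperHalfSpace n) (hT_sub : T ⊆ wall n) (hΓ_sub : Γ ⊆ wall n)
    (hstat : IsStationaryTriple θ M T Γ ψ₁ ψ₂ ψ₃)
    (ν : Eu (n + 1)) (hν : ‖ν‖ = 1) (hM_half : M ⊆ {z | inner ℝ z ν ≤ 0})
    (hM_ne : M.Nonempty) (hΓ_ne : ν = vertical n → Γ.Nonempty) :
    Real.arccos (inner ℝ ν (-vertical n)) ≤ θ ∧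
      (Real.arccos (inner ℝ ν (-vertical n)) = θ →
        M = frontier {z | inner ℝ z ν ≤ 0} ∩ upperHalfSpace n) := by
  open MeasureTheory Measure in
  have hpi := Real.pi_pos
  set α := Real.arccos (inner ℝ ν (-vertical n)) with hα
  -- `bump 0 R • ν` is admissible only when `ν · E ≥ 0`, that is, when `α ≥ π / 2`
  rcases lt_or_ge α (Real.pi / 2) with hlt | hge
  · exact ⟨(hlt.trans_le hθ.1).le, fun h => absurd (h ▸ hlt) (not_lt.2 hθ.1)⟩
  have hα_pi : α ≤ Real.pi := Real.arccos_le_pi _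
  have hbound : |inner ℝ ν (vertical n)| ≤ 1 := by
    simpa [hν, norm_vertical] using abs_real_inner_le_norm ν (vertical n)
  have hcos : Real.cos α = -inner ℝ ν (vertical n) := by
    rw [abs_le] at hbound
    rw [hα, inner_neg_right, Real.cos_arccos (by linarith) (by linarith)]
  have hc : 0 ≤ inner ℝ ν (vertical n) := by
    have := Real.cos_nonpos_of_pi_div_two_le_of_le hge (by linarith)
    linarith
  have hsin : ‖(wall n).starProjection ν‖ = Real.sin α := by
    have h1 := norm_sq_starProjection_wall ν hν
    have h2 := Real.sin_sq_add_cos_sq α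
    rw [hcos, neg_sq] at h2
    refine (sq_eq_sq₀ (norm_nonneg _) (Real.sin_nonneg_of_nonneg_of_le_pi (by linarith) hα_pi)).1 ?_
    linarith
  have hcosθ : 0 ≤ Real.cos (Real.pi - θ) := by
    rw [Real.cos_pi_sub]
    linarith [Real.cos_nonpos_of_pi_div_two_le_of_le hθ.1 (by linarith [hθ.2])]
  have hMnonpos : ∀ R, ∫ x in M, ψ₁ x * (cap 0 R x * inner ℝ x ν) ∂μHE[n] ≤ 0 := fun R => by
    refine setIntegral_nonpos hM.rectifiable.measurableSet fun x hx => ?_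
    exact mul_nonpos_of_nonneg_of_nonpos (hM.density_pos x hx).le
      (mul_nonpos_of_nonneg_of_nonpos (cap_nonneg x) (hM_half hx))
  -- the wetted term is at most its value for a conormal along the horizontal part of `ν`, and then
  -- the two terms combine to `sin (α - θ)`
  have key : ∀ R ≥ 0, Real.sin (α - θ) * (∫ x in Γ, ψ₃ x * bump 0 R x ∂μHE[n - 1]) ≤
      4 * ∫ x in M, ψ₁ x * (cap 0 R x * inner ℝ x ν) ∂μHE[n] := by
    intro R hR
    have h1 := hstat.radial_identity hM hT hT_sub hR hc
    have h2 := (abs_le.1 (hstat.abs_wetted_le hT hΓ hT_sub hR ν)).2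
    have h3 := mul_le_mul_of_nonneg_left h2 hcosθ
    rw [hsin] at h3
    rw [Real.cos_pi_sub] at h1 h3
    rw [Real.sin_sub, hcos]
    linarith
  -- if the `M`-term vanishes for all radii then `M` lies in the hyperplane
  have hplane : (∀ R > 0, ∫ x in M, ψ₁ x * (cap 0 R x * inner ℝ x ν) ∂μHE[n] = 0) →
      M ⊆ (ℝ ∙ ν)ᗮ := by
    intro h
    have := hM.subset_orthogonal (v := -ν) (fun x hx => by
      simpa [inner_neg_right] using hM_half hx) (fun R hR => by
        simpa [inner_neg_right, integral_neg] using h R hR)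
    rwa [← Set.neg_singleton, Submodule.span_neg] at this
  constructor
  · by_contra! hαθ
    have hpos : 0 < Real.sin (α - θ) :=
      Real.sin_pos_of_pos_of_lt_pi (by linarith) (by linarith [hθ.1])
    have hΓ0 : Γ = ∅ := by
      rw [Set.eq_empty_iff_forall_notMem]
      intro x hx
      have hR : 0 < ‖x‖ + 1 := by positivity
      have hint : 0 ≤ ∫ y in Γ, ψ₃ y * bump 0 (‖x‖ + 1) y ∂μHE[n - 1] :=
        setIntegral_nonneg hΓ.rectifiable.measurableSet fun y hy =>
          mul_nonneg (hΓ.density_pos y hy).le (bump_nonneg y)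
      have hz : ∫ y in Γ, ψ₃ y * bump 0 (‖x‖ + 1) y ∂μHE[n - 1] = 0 := by
        nlinarith [key _ hR.le, hMnonpos (‖x‖ + 1)]
      have := hΓ.inter_eq_empty_of_integral_eq_zero (fun y _ => bump_nonneg y)
        (hΓ.integrableOn_mul continuous_bump (hasCompactSupport_bump hR.le)) hz
        (Metric.isOpen_ball (x := 0) (ε := ‖x‖ + 1)) (fun y hy => pow_pos (cap_pos hR hy.1) 2)
      exact this.subset ⟨by simp, hx⟩
    have hνE : inner ℝ ν (vertical n) ^ 2 < 1 := by
      have hne : inner ℝ ν (vertical n) ≠ 1 := fun h =>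
        (hΓ_ne ((inner_eq_one_iff_of_norm_eq_one hν norm_vertical).1 h)).ne_empty hΓ0
      have := lt_of_le_of_ne (abs_le.1 hbound).2 hne
      nlinarith
    have hMν : M ⊆ (ℝ ∙ ν)ᗮ := hplane fun R hR => by
      have := key R hR.le
      rw [hΓ0] at this
      simp only [Measure.restrict_empty, integral_zero_measure, mul_zero] at this
      linarith [hMnonpos R]
    refine hM.not_subset_wall hM_ne hν hνE hMν ?_
    -- testing with `v = E`, the wetted term vanishes because `E` is normal to the wall
    refine hM.subset_orthogonal (fun x hx => mem_upperHalfSpace_iff.1 (hM_sub hx)) fun R hR => ?_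
    have h1 := hstat.radial_identity hM hT hT_sub hR.le (v := vertical n)
      (by simp [norm_vertical])
    have h2 : ∫ x in T, ψ₂ x * (cap 0 R x * inner ℝ x (vertical n)) ∂μHE[n] = 0 :=
      setIntegral_eq_zero_of_forall_eq_zero fun x hx => by
        rw [mem_wall_iff.1 (hT_sub hx)]; ring
    rw [h2, hΓ0] at h1
    simpa using h1
  · intro hαθ
    have hMν : M ⊆ (ℝ ∙ ν)ᗮ := hplane fun R hR => by
      have := key R hR.le
      rw [hαθ, sub_self, Real.sin_zero, zero_mul] at this
      linarith [hMnonpos R]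
    have hνE : inner ℝ ν (vertical n) ^ 2 < 1 := by
      have h1 := Real.sin_sq_add_cos_sq α
      have h2 : 0 < Real.sin α := by
        rw [hαθ]
        exact Real.sin_pos_of_pos_of_lt_pi (by linarith [hθ.1]) hθ.2
      rw [hcos, neg_sq] at h1
      nlinarith
    rw [frontier_halfSpace_inner (by rintro rfl; simp at hν)]
    exact hstat.eq_halfHyperplane hM hM_sub hM_ne hT_sub hΓ_sub hν hνE hMν
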